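/- Let $F_0=0$, $F_1=1$, $F_m(x)=xF_{m-1}(x)+F_{m-2}(x)$ be the Fibonacci polynomials. For a polynomial $f\in\mathbb{Z}_2[x]$, a minimal component of $f$ is a nonempty clopen set $S\subseteq\mathbb{Z}_2$ that is a finite union of balls, satisfies $f(S)\subseteq S$, and is such that the forward orbit of every point of $S$ is dense in $S$. The minimal decomposition of $\mathbb{Z}_2$ for $f$ is the disjoint decomposition $\mathbb{Z}_2=\mathcal P\sqcup\mathcal M\sqcup\mathcal B$, where $\mathcal P$ is the (finite) set of all periodic points of $f$, $\mathcal M=\bigsqcup_i\mathcal M_i$ is the union of all the (at most countably many, pairwise disjoint) minimal components of $f$, and each point of $\mathcal B$ lies in the attracting basin of a periodic orbit or of a minimal component. For a nonnegative integer $q$ with binary digits $c_0,c_1,c_2,\dots$ (so $q=\sum_i c_i2^i$, with $c_i=0$ for large $i$) put $t(q)=\min\{i\ge 0: c_i=c_{i+1}\}$. Let $m=2+12q$ with $q=1+2d$ for a nonnegative integer $d$, and let $t=t(q)$. Then the minimal decomposition of $\mathbb{Z}_2$ for $F_m$ is $$\mathbb{Z}_2=\{0\}\sqcup\Bigl(\bigl(\bigcup_{k=0}^{3}A_k\bigr)\cup\bigl(\bigcup_{n\ge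 1}\bigcup_{k=0}^{2^{t+1}-1}M_{n,k}\bigr)\Bigr),$$ where $$A_k=1+2k+2^3\mathbb{Z}_2,\qquad M_{n,k}=\bigl((1+4k)2^n+2^{n+t+3}\mathbb{Z}_2\bigr)\cup\bigl((2^{t+2}-1-4k)2^n+2^{n+t+3}\mathbb{Z}_2\bigr).$$ Here $0$ is a fixed point of $F_m$ and the only periodic point ($\mathcal P=\{0\}$), the sets $A_k$ ($0\le k\le 3$) and $M_{n,k}$ ($n\ge 1$, $0\le k\le 2^{t+1}-1$) are pairwise disjoint and are exactly the minimal components, and $\mathcal B=\emptyset$. -/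

import Mathlib

open Polynomial

/-- The Fibonacci polynomials: `F 0 = 0`, `F 1 = 1`, `F (m + 2) = X * F (m + 1) + F m`. -/
noncomputable def fibPoly (R : Type*) [CommRing R] : ℕ → R[X]
  | 0 => 0
  | 1 => 1
  | m + 2 => X * fibPoly R (m + 1) + fibPoly R m

/-- `c_i = c_{i+1}` holds for some `i`, the binary digits of `q` being eventually zero. -/
theorem exists_testBit_eq_succ (q : ℕ) : ∃ i : ℕ, q.testBit i = q.testBit (i + 1) := by
  refine ⟨q, ?_⟩
  have h : q < 2 ^ q := Nat.lt_two_pow_self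
  rw [Nat.testBit_lt_two_pow h,
    Nat.testBit_lt_two_pow (h.trans (Nat.pow_lt_pow_right (by norm_num) (Nat.lt_succ_self q)))]

/-- `t(q) = min {i ≥ 0 | c_i = c_{i+1}}`, where `q = c_0 + c_1 2 + c_2 2^2 + ⋯` with binary
digits `c_i` (equal to `0` beyond the leading one). -/
def digitT (q : ℕ) : ℕ := Nat.find (exists_testBit_eq_succ q)

/-- The ball `a + p^l ℤ_p`. -/
def padicBall (p : ℕ) [Fact p.Prime] (a : ℤ_[p]) (l : ℕ) : Set ℤ_[p] :=
  {x | ∃ y : ℤ_[p], x = a + (p : ℤ_[p]) ^ l * y}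

/-- `S` is a finite union of balls of `ℤ_p`. -/
def IsFiniteUnionOfBalls {p : ℕ} [Fact p.Prime] (S : Set ℤ_[p]) : Prop :=
  ∃ T : Finset (ℤ_[p] × ℕ), S = ⋃ b ∈ T, padicBall p b.1 b.2

/-- `S` is a nonempty invariant set of `f`, and the subsystem `f : S → S` is minimal: the forward
orbit of every point of `S` is dense in `S`. -/
def IsMinimalSubsystem {α : Type*} [TopologicalSpace α] (f : α → α) (S : Set α) : Prop :=
  S.Nonempty ∧ Set.MapsTo f S S ∧
    ∀ x ∈ S, S ⊆ closure (Set.range fun n : ℕ => f^[n] x)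

/-- The attracting basin of `C`: the points whose distance to `C` tends to `0` along the orbit. -/
def attractingBasin {α : Type*} [PseudoEMetricSpace α] (f : α → α) (C : Set α) : Set α :=
  {x | Filter.Tendsto (fun n : ℕ => Metric.infEDist (f^[n] x) C) Filter.atTop (nhds 0)}

/-- A minimal component of `f` on `ℤ_p`: a clopen invariant set, a finite union of balls, on which
`f` is minimal. -/
def IsMinimalComponent {p : ℕ} [Fact p.Prime] (f : ℤ_[p] → ℤ_[p]) (S : Set ℤ_[p]) : Prop :=
  IsClopen S ∧ IsFiniteUnionOfBalls S ∧ IsMinimalSubsystem f S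

/-- `ℤ_p = P ⊔ (⨆ i, M i) ⊔ B` is the minimal decomposition of `ℤ_p` for `f`. -/
structure IsMinimalDecomposition {p : ℕ} [Fact p.Prime] (f : ℤ_[p] → ℤ_[p])
    (P : Set ℤ_[p]) {ι : Type*} (M : ι → Set ℤ_[p]) (B : Set ℤ_[p]) : Prop where
  /-- The three parts cover `ℤ_p`, and they are disjoint. -/
  cover : P ∪ (⋃ i, M i) ∪ B = Set.univ
  disjoint_P_M : Disjoint P (⋃ i, M i)
  disjoint_P_B : Disjoint P B
  disjoint_M_B : Disjoint (⋃ i, M i) B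
  /-- `P` is the finite set of all periodic points of `f`. -/
  finite_P : P.Finite
  periodic : P = Function.periodicPts f
  /-- The `M i` are at most countably many pairwise disjoint sets; they are exactly the minimal
  components of `f`. -/
  countable : Countable ι
  pairwise_disjoint : Pairwise fun i j => Disjoint (M i) (M j)
  component : ∀ i, IsMinimalComponent f (M i)
  all_components : ∀ S, IsMinimalComponent f S → ∃ i, S = M i
  /-- Each point of `B` is attracted by a periodic orbit or by a minimal component. -/
  basin : ∀ x ∈ B,
    (∃ c ∈ Function.periodicPts f,
      x ∈ attractingBasin f (Set.range fun n : ℕ => f^[n] c)) ∨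
    ∃ i, x ∈ attractingBasin f (M i)

/-- `A_k = 1 + 2k + 2^3 ℤ_2`. -/
def componentA (k : ℕ) : Set ℤ_[2] := padicBall 2 (1 + 2 * (k : ℤ_[2])) 3

/-- `M_{n,k} = ((1 + 4k) 2^n + 2^(n+t+3) ℤ_2) ∪ ((2^(t+2) - 1 - 4k) 2^n + 2^(n+t+3) ℤ_2)`. -/
def componentM (t n k : ℕ) : Set ℤ_[2] :=
  padicBall 2 ((1 + 4 * (k : ℤ_[2])) * 2 ^ n) (n + t + 3) ∪
    padicBall 2 ((2 ^ (t + 2) - 1 - 4 * (k : ℤ_[2])) * 2 ^ n) (n + t + 3)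

/-! Write `f` for `F_m` and `j = 6q`, so `m = 2j + 2` with `j` even. Cassini's identity gives `f(x)
- x = F_j L_{j+2}` and `f(x) + x = F_{j+2} L_j`, with `L` the Lucas polynomials. These
factorizations yield exact 2-adic sizes: for odd `x`, `f(x) - x` is `8` times an odd number
(`exists_odd_fibAt_sub_self`). For even `x`, `f(x) + x` is `2^(t+2) x` times an odd number
(`exists_odd_fibAt_add_self`), because `t + 1` is the exponent of `2` in `1 + 3q`
(`one_add_three_mul_eq_two_pow`).

Minimality comes from `padicBall_subset_closure_orbit`: if every displacement `h(x) - x` is `2^L`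
times an odd number and varies by multiples of `4(x - y)`, then the orbit of `x` is dense in `x +
2^L ℤ_2`. For odd points take `h = f`, `L = 3`. On `2^n` times the odd numbers, `f` is close to `x ↦
-x`, so take `h = f ∘ f`, `L = n + t + 3`; `f` itself swaps the two balls of `M_{n,k}`.

These components cover everything except `0`, which determines the rest of the decomposition
(`isMinimalDecomposition_of_components`). -/

/-- The value at `x` of the `n`-th Fibonacci polynomial. -/
def fibAt {R : Type*} [CommRing R] (x : R) : ℕ → R
  | 0 => 0
  | 1 => 1
  | n + 2 => x * fibAt x (n + 1) + fibAt x n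

/-! ### Identities and divisibility for Fibonacci and Lucas values -/

section fibAt

variable {R : Type*} [CommRing R] (x : R)

theorem fibAt_add_two (n : ℕ) : fibAt x (n + 2) = x * fibAt x (n + 1) + fibAt x n := rfl

theorem eval_fibPoly (n : ℕ) : (fibPoly R n).eval x = fibAt x n := by
  induction n using Nat.twoStepInduction with
  | zero => simp [fibPoly, fibAt]
  | one => simp [fibPoly, fibAt]
  | more n h0 h1 => rw [fibPoly, fibAt_add_two, eval_add, eval_mul, eval_X, h0, h1]

theorem map_fibAt {S : Type*} [CommRing S] (φ : R →+* S) (n : ℕ) :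
    φ (fibAt x n) = fibAt (φ x) n := by
  induction n using Nat.twoStepInduction with
  | zero => simp [fibAt]
  | one => simp [fibAt]
  | more n h0 h1 => rw [fibAt_add_two, fibAt_add_two, map_add, map_mul, h0, h1]

theorem fibAt_neg (n : ℕ) : fibAt (-x) n = (-1) ^ (n + 1) * fibAt x n := by
  induction n using Nat.twoStepInduction with
  | zero => simp [fibAt]
  | one => simp [fibAt]
  | more n h0 h1 => rw [fibAt_add_two, fibAt_add_two, h0, h1]; ring

theorem fibAt_add (a b : ℕ) :
    fibAt x (a + b + 1) = fibAt x (a + 1) * fibAt x (b + 1) + fibAt x a * fibAt x b := by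
  induction b using Nat.twoStepInduction with
  | zero => simp [fibAt]
  | one => simp [fibAt]; ring
  | more n h0 h1 =>
    rw [show a + (n + 2) + 1 = (a + n + 1) + 2 by ring, fibAt_add_two, h0,
      show a + n + 1 + 1 = a + (n + 1) + 1 by ring, h1, fibAt_add_two x (n + 1), fibAt_add_two x n]
    ring

theorem fibAt_dvd_mul (a b : ℕ) : fibAt x a ∣ fibAt x (a * b) := by
  rcases a with _ | a
  · simp
  induction b with
  | zero => simp [fibAt]
  | succ b ih =>
    rw [show (a + 1) * (b + 1) = (a + 1) * b + a + 1 by ring, fibAt_add]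
    exact dvd_add (dvd_mul_left _ _) (ih.mul_right _)

theorem fibAt_cassini (n : ℕ) :
    fibAt x (n + 1) ^ 2 - x * fibAt x n * fibAt x (n + 1) - fibAt x n ^ 2 = (-1) ^ n := by
  induction n with
  | zero => simp [fibAt]
  | succ n ih => rw [fibAt_add_two, pow_succ (-1 : R) n, ← ih]; ring

/-- The value at `x` of the `n`-th Lucas polynomial. -/
def lucAt (n : ℕ) : R := 2 * fibAt x (n + 1) - x * fibAt x n

theorem fibAt_two_mul (n : ℕ) : fibAt x (2 * n) = fibAt x n * lucAt x n := by
  rcases n with _ | n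
  · simp [fibAt]
  rw [show 2 * (n + 1) = (n + 1) + n + 1 by ring, fibAt_add, lucAt, fibAt_add_two x n]
  ring

/-- After expanding by the addition formula, the difference of the two sides is `x` times Cassini's
relation at `j`; evenness fixes its sign. -/
theorem fibAt_sub_eq_mul {j : ℕ} (hj : Even j) :
    fibAt x (2 * j + 2) - x = fibAt x j * lucAt x (j + 2) := by
  have h := fibAt_cassini x j
  rw [hj.neg_one_pow] at h
  rw [show 2 * j + 2 = (j + 1) + j + 1 by ring, fibAt_add, lucAt, fibAt_add_two x (j + 1),
    fibAt_add_two x j]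
  linear_combination x * h

theorem fibAt_add_eq_mul {j : ℕ} (hj : Even j) :
    fibAt x (2 * j + 2) + x = fibAt x (j + 2) * lucAt x j := by
  have h := fibAt_cassini x j
  rw [hj.neg_one_pow] at h
  rw [show 2 * j + 2 = (j + 1) + j + 1 by ring, fibAt_add, lucAt, fibAt_add_two x j]
  linear_combination (-x) * h

theorem four_dvd_fibAt_of_even {x : R} (hx : Even x) (n : ℕ) : 4 ∣ fibAt x (4 * n) := by
  obtain ⟨u, rfl⟩ := hx
  refine Dvd.dvd.trans ⟨u * (2 * u ^ 2 + 1), ?_⟩ (fibAt_dvd_mul (u + u) 4 n)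
  simp only [fibAt]; ring

theorem two_dvd_lucAt_of_even {x : R} (hx : Even x) (n : ℕ) : 2 ∣ lucAt x n := by
  obtain ⟨u, rfl⟩ := hx
  exact ⟨fibAt (u + u) (n + 1) - u * fibAt (u + u) n, by rw [lucAt]; ring⟩

theorem fibAt_six_of_odd (u : R) :
    fibAt (2 * u + 1) 6 = 8 * ((2 * u + 1) * (2 * u ^ 2 + 2 * u + 1) * (u ^ 2 + u + 1)) := by
  simp only [fibAt]; ring

theorem eight_dvd_fibAt_of_odd {x : R} (hx : Odd x) (n : ℕ) : 8 ∣ fibAt x (6 * n) := by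
  obtain ⟨u, rfl⟩ := hx
  exact Dvd.dvd.trans ⟨_, fibAt_six_of_odd u⟩ (fibAt_dvd_mul _ 6 n)

theorem sixteen_dvd_fibAt_of_odd {x : R} (hx : Odd x) (n : ℕ) : 16 ∣ fibAt x (12 * n) := by
  refine Dvd.dvd.trans ?_ (fibAt_dvd_mul x 12 n)
  obtain ⟨u, rfl⟩ := hx
  -- `F_12 = F_6 L_6`, where `8 ∣ F_6` and `L_6 = 2 F_7 - x F_6` supplies one more factor `2`.
  have h := fibAt_two_mul (2 * u + 1) 6
  rw [fibAt_six_of_odd, lucAt, fibAt_six_of_odd] at h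
  norm_num at h
  rw [h]
  exact ⟨((2 * u + 1) * (2 * u ^ 2 + 2 * u + 1) * (u ^ 2 + u + 1)) *
    (fibAt (2 * u + 1) 7 - 4 * (2 * u + 1) *
      ((2 * u + 1) * (2 * u ^ 2 + 2 * u + 1) * (u ^ 2 + u + 1))), by ring⟩

end fibAt

/-! ### Binary digits and the valuation of `1 + 3q` -/

/-- The 2-adic expansion of `-1/3` alternates `1, 0, 1, 0, …`, so `t` measures how long an odd `q`
agrees with it. The induction removes a leading pair `1, 0`: if `q = 4s + 1` then `1 + 3q = 4(1 +
3s)`, and `t` drops by `2` when `s` is odd. -/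
theorem one_add_three_mul_eq_two_pow {q : ℕ} (hq : Odd q) :
    ∃ w, Odd w ∧ 1 + 3 * q = 2 ^ (digitT q + 1) * w := by
  induction q using Nat.strong_induction_on with
  | _ q ih =>
    obtain ⟨r, rfl⟩ := hq
    have h0 : (2 * r + 1).testBit 0 = true := by simp
    have hs (i : ℕ) : (2 * r + 1).testBit (i + 1) = r.testBit i := by
      rw [Nat.testBit_succ]; congr 1; omega
    rcases Nat.even_or_odd r with ⟨s, rfl⟩ | hr
    · have hs' (i : ℕ) : (s + s).testBit (i + 1) = s.testBit i := by
        rw [Nat.testBit_succ]; congr 1; omega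
      have hss : (s + s).testBit 0 = false := by rw [Nat.testBit_zero, decide_eq_false]; omega
      rcases Nat.even_or_odd s with hse | hso
      · have ht : digitT (2 * (s + s) + 1) = 1 := by
          rw [digitT, Nat.find_eq_iff]
          refine ⟨?_, ?_⟩
          · rw [hs, hs, hs', hss, Nat.testBit_zero, eq_comm, decide_eq_false]
            obtain ⟨k, rfl⟩ := hse; omega
          · intro n hn
            obtain rfl : n = 0 := by omega
            rw [h0, hs, hss]; simp
        obtain ⟨k, rfl⟩ := hse
        exact ⟨1 + 6 * k, ⟨3 * k, by ring⟩, by rw [ht]; ring⟩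
      · have hs0 : s.testBit 0 = true := by
          rw [Nat.testBit_zero, decide_eq_true]; exact Nat.odd_iff.mp hso
        have ht : digitT (2 * (s + s) + 1) = digitT s + 2 := by
          rw [digitT, Nat.find_eq_iff]
          refine ⟨?_, ?_⟩
          · rw [hs, hs, hs', hs']
            exact Nat.find_spec (exists_testBit_eq_succ s)
          · intro n hn
            rcases n with _ | _ | n
            · rw [h0, hs, hss]; simp
            · rw [hs, hs, hs', hss, hs0]; simp
            · rw [hs, hs, hs', hs']
              exact Nat.find_min (exists_testBit_eq_succ s) (by rw [digitT] at hn; omega)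
        obtain ⟨w, hw, h⟩ := ih s (by omega) hso
        exact ⟨w, hw, by rw [ht]; linear_combination 4 * h⟩
    · have ht : digitT (2 * r + 1) = 0 := by
        rw [digitT, Nat.find_eq_zero, h0, hs, Nat.testBit_zero, eq_comm, decide_eq_true]
        exact Nat.odd_iff.mp hr
      obtain ⟨k, rfl⟩ := hr
      exact ⟨5 + 6 * k, ⟨3 * k + 2, by ring⟩, by rw [ht]; ring⟩

/-! ### Parity and balls in `ℤ_2` -/

theorem PadicInt.even_or_odd (x : ℤ_[2]) : Even x ∨ Odd x := by
  obtain ⟨n, hn, h⟩ := PadicInt.exists_mem_range x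
  rw [PadicInt.maximalIdeal_eq_span_p, Ideal.mem_span_singleton] at h
  obtain ⟨c, hc⟩ := h
  have hx : x = n + 2 * c := by rw [← sub_eq_iff_eq_add']; exact_mod_cast hc
  interval_cases n
  · left; exact ⟨c, by rw [hx]; push_cast; ring⟩
  · right; exact ⟨c, by rw [hx]; push_cast; ring⟩

theorem PadicInt.not_even_of_odd {x : ℤ_[2]} (hx : Odd x) : ¬ Even x := by
  rintro ⟨c, rfl⟩
  obtain ⟨d, hd⟩ := hx
  have h : IsUnit ((2 : ℕ) : ℤ_[2]) :=
    IsUnit.of_mul_eq_one (c - d) (by push_cast; linear_combination hd)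
  exact PadicInt.p_nonunit h

theorem PadicInt.odd_of_odd_sq {x : ℤ_[2]} (hx : Odd (x ^ 2)) : Odd x :=
  (PadicInt.even_or_odd x).resolve_left fun h =>
    PadicInt.not_even_of_odd hx (h.pow_of_ne_zero two_ne_zero)

theorem PadicInt.exists_eq_two_pow_mul_odd {x : ℤ_[2]} (hx : x ≠ 0) :
    ∃ n u, Odd u ∧ x = 2 ^ n * u := by
  refine ⟨x.valuation, PadicInt.unitCoeff hx, ?_, ?_⟩
  · refine (PadicInt.even_or_odd _).resolve_left ?_
    rintro ⟨c, hc⟩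
    refine PadicInt.p_nonunit (p := 2)
      (isUnit_of_dvd_unit (y := ↑(PadicInt.unitCoeff hx)) ⟨c, ?_⟩ (Units.isUnit _))
    rw [hc]; push_cast; ring
  · have := PadicInt.unitCoeff_spec hx
    rw [mul_comm]; exact_mod_cast this

theorem mem_padicBall_iff {a x : ℤ_[2]} {l : ℕ} : x ∈ padicBall 2 a l ↔ 2 ^ l ∣ x - a := by
  constructor
  · rintro ⟨y, rfl⟩; exact ⟨y, by push_cast; ring⟩
  · rintro ⟨y, hy⟩; exact ⟨y, by push_cast; linear_combination hy⟩

theorem padicBall_eq_closedBall (a : ℤ_[2]) (l : ℕ) :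
    padicBall 2 a l = Metric.closedBall a ((2 : ℝ) ^ (-l : ℤ)) := by
  ext x
  have := PadicInt.norm_le_pow_iff_mem_span_pow (p := 2) (x - a) l
  rw [mem_padicBall_iff, Metric.mem_closedBall, dist_eq_norm, ← Ideal.mem_span_singleton]
  exact_mod_cast this.symm

theorem isClopen_padicBall (a : ℤ_[2]) (l : ℕ) : IsClopen (padicBall 2 a l) := by
  rw [padicBall_eq_closedBall]
  exact IsUltrametricDist.isClopen_closedBall _ (by positivity)

theorem mem_closure_iff_two_pow_dvd {S : Set ℤ_[2]} {z : ℤ_[2]} :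
    z ∈ closure S ↔ ∀ k : ℕ, ∃ y ∈ S, 2 ^ k ∣ y - z := by
  constructor
  · intro h k
    obtain ⟨y, hy, hyS⟩ := mem_closure_iff.mp h _ (isClopen_padicBall z k).isOpen
      (mem_padicBall_iff.mpr (by simp))
    exact ⟨y, hyS, mem_padicBall_iff.mp hy⟩
  · intro h
    rw [Metric.mem_closure_iff]
    intro ε hε
    obtain ⟨k, hk⟩ := exists_pow_lt_of_lt_one hε (show (1 / 2 : ℝ) < 1 by norm_num)
    obtain ⟨y, hyS, hy⟩ := h k
    refine ⟨y, hyS, ?_⟩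
    rw [← mem_padicBall_iff, padicBall_eq_closedBall, Metric.mem_closedBall] at hy
    rw [dist_comm]
    refine hy.trans_lt ?_
    rw [zpow_neg, zpow_natCast, ← inv_pow]
    simpa using hk

theorem infinite_padicBall (a : ℤ_[2]) (l : ℕ) : (padicBall 2 a l).Infinite := by
  intro h
  have hinj : Function.Injective fun n : ℕ => a + 2 ^ l * (n : ℤ_[2]) := by
    intro m n hmn
    simpa using hmn
  exact Set.infinite_range_of_injective hinj
    (h.subset (by rintro _ ⟨n, rfl⟩; exact mem_padicBall_iff.mpr ⟨n, by ring⟩))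

/-! ### Density of orbits from displacements -/

/-- Squaring the displacement: the iterates `h^[2^k]` move each point by `2 ^ (L + k)` times an
odd number, when `h - id` is divisible by `4` times the increment. -/
theorem iterate_two_pow_displacement {E : Set ℤ_[2]} {L : ℕ} {h : ℤ_[2] → ℤ_[2]}
    (hE : Set.MapsTo h E E) (hd : ∀ x ∈ E, ∃ u, Odd u ∧ h x - x = 2 ^ L * u)
    (hL : ∀ x ∈ E, ∀ y ∈ E, 4 * (x - y) ∣ (h x - x) - (h y - y)) (k : ℕ) :
    (∀ x ∈ E, ∃ u, Odd u ∧ h^[2 ^ k] x - x = 2 ^ (L + k) * u) ∧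
      ∀ x ∈ E, ∀ y ∈ E, 4 * (x - y) ∣ (h^[2 ^ k] x - x) - (h^[2 ^ k] y - y) := by
  induction k with
  | zero => simpa using ⟨hd, hL⟩
  | succ k ih =>
    obtain ⟨ih1, ih2⟩ := ih
    have hE' := hE.iterate (2 ^ k)
    have h2 (x : ℤ_[2]) : h^[2 ^ (k + 1)] x = h^[2 ^ k] (h^[2 ^ k] x) := by
      rw [pow_succ, mul_two, Function.iterate_add_apply]
    simp only [h2]
    generalize h^[2 ^ k] = H at *
    constructor
    · intro x hx
      obtain ⟨u, hu, hxu⟩ := ih1 x hx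
      obtain ⟨c, hc⟩ := ih2 _ (hE' hx) x hx
      -- The displacements at `x` and `H x` differ by `4 (H x - x) c`, so that of `H ∘ H` is `2 (H x
      -- - x)(1 + 2c)`.
      refine ⟨u + 2 * (u * c), hu.add_even (even_two_mul _), ?_⟩
      rw [hxu] at hc
      rw [← add_assoc, pow_succ]
      linear_combination hc + hxu
    · intro x hx y hy
      obtain ⟨c, hc⟩ := ih2 x hx y hy
      obtain ⟨e, he⟩ := ih2 _ (hE' hx) _ (hE' hy)
      refine ⟨c + (1 + 4 * c) * e, ?_⟩
      linear_combination he + hc + 4 * e * hc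

/-- The target is approximated one binary digit at a time: when the error is exactly `2^(L+k)` times
an odd number, `2^k` further iterations add another such number, and odd plus odd is even. -/
theorem padicBall_subset_closure_orbit {E : Set ℤ_[2]} {L : ℕ} {h : ℤ_[2] → ℤ_[2]}
    (hE : Set.MapsTo h E E) (hd : ∀ x ∈ E, ∃ u, Odd u ∧ h x - x = 2 ^ L * u)
    (hL : ∀ x ∈ E, ∀ y ∈ E, 4 * (x - y) ∣ (h x - x) - (h y - y)) {x : ℤ_[2]} (hx : x ∈ E) :
    padicBall 2 x L ⊆ closure (Set.range fun n : ℕ => h^[n] x) := by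
  intro z hz
  rw [mem_padicBall_iff] at hz
  have key (k : ℕ) : ∃ n : ℕ, 2 ^ (L + k) ∣ h^[n] x - z := by
    induction k with
    | zero => exact ⟨0, by simpa using (dvd_sub_comm.mp hz)⟩
    | succ k ih =>
      obtain ⟨n, v, hv⟩ := ih
      rcases PadicInt.even_or_odd v with ⟨c, rfl⟩ | hvo
      · exact ⟨n, c, by rw [hv]; ring⟩
      · obtain ⟨u, hu, hxu⟩ :=
          (iterate_two_pow_displacement hE hd hL k).1 _ (hE.iterate n hx)
        obtain ⟨c, hc⟩ := hu.add_odd hvo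
        refine ⟨2 ^ k + n, c, ?_⟩
        rw [Function.iterate_add_apply]
        linear_combination hxu + hv + 2 ^ (L + k) * hc
  rw [mem_closure_iff_two_pow_dvd]
  intro k
  obtain ⟨n, hn⟩ := key k
  exact ⟨_, ⟨n, rfl⟩, (pow_dvd_pow 2 (Nat.le_add_left k L)).trans hn⟩

theorem odd_fibAt_succ {x : ℤ_[2]} {n : ℕ} (hn : Even n) (h : Even (fibAt x n)) :
    Odd (fibAt x (n + 1)) := by
  apply PadicInt.odd_of_odd_sq
  have hc := fibAt_cassini x n
  rw [hn.neg_one_pow] at hc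
  obtain ⟨c, hc'⟩ := h
  exact ⟨c * x * fibAt x (n + 1) + 2 * c ^ 2, by
    linear_combination hc + (x * fibAt x (n + 1) + fibAt x n + 2 * c) * hc'⟩

/-- If `P(2u + c) = 8 G(u)`, then `u - v ∣ G(u) - G(v)`, and `8(u - v) = 4(x - y)`. The divisibility
by `8` must hold between polynomials, hence the Fibonacci values over an arbitrary ring, here taken
at `2X + c`. -/
theorem four_mul_sub_dvd_eval_sub {P : ℤ_[2][X]} {c : ℤ_[2]} (hP : 8 ∣ P.comp (2 * X + C c))
    {x y : ℤ_[2]} (hx : 2 ∣ x - c) (hy : 2 ∣ y - c) : 4 * (x - y) ∣ P.eval x - P.eval y := by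
  obtain ⟨G, hG⟩ := hP
  have key (u : ℤ_[2]) : P.eval (2 * u + c) = 8 * G.eval u := by
    have h := congrArg (eval u) hG
    rw [eval_comp, eval_mul] at h
    simpa using h
  obtain ⟨u, hu⟩ := hx
  obtain ⟨v, hv⟩ := hy
  obtain rfl : x = 2 * u + c := by linear_combination hu
  obtain rfl : y = 2 * v + c := by linear_combination hv
  obtain ⟨e, he⟩ := sub_dvd_eval_sub u v G
  refine ⟨e, ?_⟩
  rw [key, key]
  linear_combination 8 * he

theorem eval_fibAt_X (x : ℤ_[2]) (n : ℕ) : (fibAt (X : ℤ_[2][X]) n).eval x = fibAt x n := by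
  simpa using map_fibAt (X : ℤ_[2][X]) (evalRingHom x) n

theorem fibAt_X_comp (Q : ℤ_[2][X]) (n : ℕ) : (fibAt (X : ℤ_[2][X]) n).comp Q = fibAt Q n := by
  simpa using map_fibAt (X : ℤ_[2][X]) (compRingHom Q) n

/-! ### Displacement at odd points -/

section odd

variable {q : ℕ} {x y : ℤ_[2]}

theorem fibAt_sub_self_sub_dvd_of_odd (hx : Odd x) (hy : Odd y) :
    4 * (x - y) ∣ (fibAt x (2 + 12 * q) - x) - (fibAt y (2 + 12 * q) - y) := by
  have h8 : (8 : ℤ_[2][X]) ∣ (fibAt X (2 + 12 * q) - X : ℤ_[2][X]).comp (2 * X + C 1) := by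
    rw [sub_comp, fibAt_X_comp, X_comp, show 2 + 12 * q = 2 * (6 * q) + 2 by ring,
      fibAt_sub_eq_mul _ ⟨3 * q, by ring⟩]
    exact (eight_dvd_fibAt_of_odd ⟨X, by simp⟩ q).mul_right _
  obtain ⟨u, rfl⟩ := hx
  obtain ⟨v, rfl⟩ := hy
  simpa [eval_fibAt_X] using four_mul_sub_dvd_eval_sub h8 (x := 2 * u + 1) (y := 2 * v + 1)
    ⟨u, by ring⟩ ⟨v, by ring⟩

theorem exists_odd_fibAt_sub_self (hq : Odd q) (hx : Odd x) :
    ∃ u, Odd u ∧ fibAt x (2 + 12 * q) - x = 2 ^ 3 * u := by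
  have hev (n : ℕ) : Even (fibAt x (6 * n)) :=
    even_iff_two_dvd.mpr (Dvd.dvd.trans ⟨4, by norm_num⟩ (eight_dvd_fibAt_of_odd hx n))
  have h1 : Odd (lucAt x (6 * q + 2)) := by
    rw [lucAt, fibAt_add_two]
    exact (even_two_mul _).sub_odd
      (hx.mul ((hx.mul (odd_fibAt_succ ⟨3 * q, by ring⟩ (hev q))).add_even (hev q)))
  obtain ⟨r, rfl⟩ := hq
  have h2 : Odd (fibAt x (12 * r + 1)) :=
    odd_fibAt_succ ⟨6 * r, by ring⟩ (by convert hev (2 * r) using 2; ring)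
  obtain ⟨c, hc⟩ := sixteen_dvd_fibAt_of_odd hx r
  obtain ⟨u, rfl⟩ := id hx
  have h3 : Odd ((2 * u + 1) * (2 * u ^ 2 + 2 * u + 1) * (u ^ 2 + u + 1)) := by
    refine (hx.mul ⟨u ^ 2 + u, by ring⟩).mul (Even.add_one ?_)
    rcases PadicInt.even_or_odd u with h | h
    · exact (h.pow_of_ne_zero two_ne_zero).add h
    · exact h.pow.add_odd h
  refine ⟨_, Odd.mul ((h2.mul h3).add_even (even_two_mul (c * fibAt (2 * u + 1) 5))) h1, ?_⟩
  rw [show 2 + 12 * (2 * r + 1) = 2 * (6 * (2 * r + 1)) + 2 by ring,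
    fibAt_sub_eq_mul _ ⟨3 * (2 * r + 1), by ring⟩]
  -- `F_{12r+6} = F_{12r+1} F_6 + F_{12r} F_5`: the first term is `8` times an odd number, the
  -- second is divisible by `16`.
  rw [show fibAt (2 * u + 1) (6 * (2 * r + 1)) = fibAt (2 * u + 1) (12 * r + 5 + 1) by
    congr 1; ring, fibAt_add, hc, fibAt_six_of_odd]
  ring

end odd

/-! ### Displacement at even points -/

section even

variable {q : ℕ} {x y : ℤ_[2]}

theorem fibAt_add_self_sub_dvd_of_even (hq : Odd q) (hx : Even x) (hy : Even y) :
    4 * (x - y) ∣ (fibAt x (2 + 12 * q) + x) - (fibAt y (2 + 12 * q) + y) := by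
  obtain ⟨r, rfl⟩ := hq
  have h8 : (8 : ℤ_[2][X]) ∣
      (fibAt X (2 + 12 * (2 * r + 1)) + X : ℤ_[2][X]).comp (2 * X + C 0) := by
    rw [add_comp, fibAt_X_comp, X_comp,
      show 2 + 12 * (2 * r + 1) = 2 * (6 * (2 * r + 1)) + 2 by ring,
      fibAt_add_eq_mul _ ⟨3 * (2 * r + 1), by ring⟩,
      -- For odd `q` the index `6q + 2` is a multiple of `4`, so the Fibonacci factor gives `4` and
      -- the Lucas factor `2`.
      show 6 * (2 * r + 1) + 2 = 4 * (3 * r + 2) by ring]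
    have he : Even (2 * X + C 0 : ℤ_[2][X]) := ⟨X, by simp [two_mul]⟩
    convert mul_dvd_mul (four_dvd_fibAt_of_even he (3 * r + 2))
      (two_dvd_lucAt_of_even he (6 * (2 * r + 1))) using 1
    norm_num
  simpa [eval_fibAt_X] using four_mul_sub_dvd_eval_sub h8 (x := x) (y := y)
    (by simpa using even_iff_two_dvd.mp hx) (by simpa using even_iff_two_dvd.mp hy)

theorem dvd_fibAt_two_mul (n : ℕ) : x ∣ fibAt x (2 * n) :=
  Dvd.dvd.trans ⟨1, by simp [fibAt]⟩ (fibAt_dvd_mul x 2 n)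

theorem exists_odd_lucAt_of_even (hx : Even x) (n : ℕ) :
    ∃ u, Odd u ∧ lucAt x (2 * n) = 2 * u := by
  have h : Even (fibAt x (2 * n)) :=
    even_iff_two_dvd.mpr ((even_iff_two_dvd.mp hx).trans (dvd_fibAt_two_mul n))
  have h1 := odd_fibAt_succ (even_two_mul n) h
  obtain ⟨u, rfl⟩ := hx
  exact ⟨_, h1.sub_even (h.mul_left u), by rw [lucAt]; ring⟩

/-- In `F_{2n} = F_n L_n`, an odd `n` has `F_n` odd and `L_n` equal to `x` times an odd number;
every later doubling contributes `L_n = 2 · odd`. -/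
theorem exists_odd_fibAt_of_even (hx : Even x) {w : ℕ} (hw : Odd w) (s : ℕ) :
    ∃ u, Odd u ∧ fibAt x (2 ^ (s + 1) * w) = 2 ^ s * x * u := by
  induction s with
  | zero =>
    obtain ⟨v, rfl⟩ := hw
    have h1 : Odd (fibAt x (2 * v + 1)) := odd_fibAt_succ (even_two_mul v)
      (even_iff_two_dvd.mpr ((even_iff_two_dvd.mp hx).trans (dvd_fibAt_two_mul v)))
    obtain ⟨c, hc⟩ := dvd_fibAt_two_mul (x := x) (v + 1)
    refine ⟨_, h1.mul ((even_two_mul c).sub_odd h1), ?_⟩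
    rw [zero_add, pow_one, fibAt_two_mul, lucAt, show 2 * v + 1 + 1 = 2 * (v + 1) by ring, hc]
    ring
  | succ s ih =>
    obtain ⟨u, hu, hxu⟩ := ih
    obtain ⟨v, hv, hxv⟩ := exists_odd_lucAt_of_even hx (2 ^ s * w)
    refine ⟨u * v, hu.mul hv, ?_⟩
    rw [show 2 ^ (s + 1 + 1) * w = 2 * (2 ^ (s + 1) * w) by ring, fibAt_two_mul, hxu,
      show 2 ^ (s + 1) * w = 2 * (2 ^ s * w) by ring, hxv]
    ring

theorem exists_odd_fibAt_add_self (hq : Odd q) (hx : Even x) :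
    ∃ u, Odd u ∧ fibAt x (2 + 12 * q) + x = 2 ^ (digitT q + 2) * x * u := by
  obtain ⟨w, hw, h⟩ := one_add_three_mul_eq_two_pow hq
  obtain ⟨u, hu, hxu⟩ := exists_odd_fibAt_of_even hx hw (digitT q + 1)
  obtain ⟨v, hv, hxv⟩ := exists_odd_lucAt_of_even hx (3 * q)
  refine ⟨u * v, hu.mul hv, ?_⟩
  rw [show 2 + 12 * q = 2 * (6 * q) + 2 by ring, fibAt_add_eq_mul _ ⟨3 * q, by ring⟩,
    show 6 * q + 2 = 2 ^ (digitT q + 1 + 1) * w by linear_combination 2 * h, hxu,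
    show 6 * q = 2 * (3 * q) by ring, hxv]
  ring

theorem even_fibAt_of_even (hx : Even x) : Even (fibAt x (2 + 12 * q)) := by
  rw [show 2 + 12 * q = 2 * (1 + 6 * q) by ring]
  exact even_iff_two_dvd.mpr ((even_iff_two_dvd.mp hx).trans (dvd_fibAt_two_mul _))

theorem fibAt_fibAt_sub_self_sub_dvd_of_even (hq : Odd q) (hx : Even x) (hy : Even y) :
    4 * (x - y) ∣ (fibAt (fibAt x (2 + 12 * q)) (2 + 12 * q) - x) -
      (fibAt (fibAt y (2 + 12 * q)) (2 + 12 * q) - y) := by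
  obtain ⟨c, hc⟩ := fibAt_add_self_sub_dvd_of_even hq hx hy
  obtain ⟨e, he⟩ := fibAt_add_self_sub_dvd_of_even hq (even_fibAt_of_even (q := q) hx)
    (even_fibAt_of_even (q := q) hy)
  -- With `g = f + id`, the displacement of `f ∘ f` is `g(f x) - g(x)`, and `f x - f y = (4c - 1)(x
  -- - y)`.
  exact ⟨(4 * c - 1) * e - c, by linear_combination he - hc + 4 * e * hc⟩

theorem exists_odd_fibAt_fibAt_sub_self (hq : Odd q) (hx : Even x) :
    ∃ u, Odd u ∧ fibAt (fibAt x (2 + 12 * q)) (2 + 12 * q) - x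
      = 2 ^ (digitT q + 3) * x * u := by
  obtain ⟨u, hu, hxu⟩ := exists_odd_fibAt_add_self hq hx
  -- Since `f` is an odd function and `f x` is near `-x`, comparing `f + id` at `-f x` and `x` gives
  -- `f(f x) - x = (f x + x)(4e - 2)`, one power of `2` beyond `f x + x`.
  obtain ⟨e, he⟩ := fibAt_add_self_sub_dvd_of_even hq (even_fibAt_of_even (q := q) hx).neg hx
  rw [fibAt_neg, show 2 + 12 * q + 1 = 2 * (1 + 6 * q) + 1 by ring, pow_succ, pow_mul] at he
  norm_num at he
  refine ⟨-u + 2 * (u * e), hu.neg.add_even (even_two_mul _), ?_⟩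
  rw [pow_succ]
  linear_combination -he - (2 - 4 * e) * hxu

end even

/-! ### From a family of components to the decomposition -/

theorem exists_padicBall_subset {S : Set ℤ_[2]} (hS : IsOpen S) {x : ℤ_[2]} (hx : x ∈ S) :
    ∃ l, padicBall 2 x l ⊆ S := by
  by_contra! h
  have : x ∈ closure Sᶜ := by
    rw [mem_closure_iff_two_pow_dvd]
    intro k
    obtain ⟨y, hy, hyS⟩ := Set.not_subset.mp (h k)
    exact ⟨y, hyS, mem_padicBall_iff.mp hy⟩
  rw [hS.isClosed_compl.closure_eq] at this
  exact this hx

theorem infinite_of_isOpen {S : Set ℤ_[2]} (hS : IsOpen S) (hne : S.Nonempty) : S.Infinite := by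
  obtain ⟨x, hx⟩ := hne
  obtain ⟨l, hl⟩ := exists_padicBall_subset hS hx
  exact (infinite_padicBall x l).mono hl

theorem IsMinimalComponent.subset {f : ℤ_[2] → ℤ_[2]} {S T : Set ℤ_[2]}
    (hS : IsMinimalComponent f S) (hT : IsMinimalComponent f T) {x : ℤ_[2]} (hxS : x ∈ S)
    (hxT : x ∈ T) : S ⊆ T := by
  refine (hS.2.2.2.2 x hxS).trans (closure_minimal ?_ hT.1.isClosed)
  rintro _ ⟨n, rfl⟩
  exact hT.2.2.2.1.iterate n hxT

/-- A nonzero periodic point would have a finite, hence closed, orbit dense in an infinite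
component. Any minimal component is infinite, so it meets some `M i`, and components sharing a point
coincide. -/
theorem isMinimalDecomposition_of_components {f : ℤ_[2] → ℤ_[2]} (hf : f 0 = 0) {ι : Type*}
    [Countable ι] {M : ι → Set ℤ_[2]} (hcover : ∀ x ≠ 0, ∃ i, x ∈ M i) (h0 : ∀ i, 0 ∉ M i)
    (hdisj : Pairwise fun i j => Disjoint (M i) (M j)) (hM : ∀ i, IsMinimalComponent f (M i)) :
    IsMinimalDecomposition f {0} M ∅ where
  cover := by
    refine Set.eq_univ_of_forall fun x => ?_
    by_cases hx : x = 0
    · simp [hx]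
    · obtain ⟨i, hi⟩ := hcover x hx
      exact Or.inl (Or.inr (Set.mem_iUnion_of_mem i hi))
  disjoint_P_M := by simpa using h0
  disjoint_P_B := Set.disjoint_empty _
  disjoint_M_B := Set.disjoint_empty _
  finite_P := Set.finite_singleton 0
  periodic := by
    ext x
    rw [Set.mem_singleton_iff]
    constructor
    · rintro rfl
      exact ⟨1, one_pos, hf⟩
    · rintro ⟨n, hn, hx⟩
      by_contra hne
      obtain ⟨i, hi⟩ := hcover x hne
      have hfin : (Set.range fun k : ℕ => f^[k] x).Finite := by
        refine ((Set.finite_lt_nat n).image fun k => f^[k] x).subset ?_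
        rintro _ ⟨k, rfl⟩
        exact ⟨k % n, Nat.mod_lt k hn, hx.iterate_mod_apply k⟩
      refine infinite_of_isOpen (hM i).1.isOpen ⟨x, hi⟩ (hfin.subset ?_)
      have := (hM i).2.2.2.2 x hi
      rwa [hfin.isClosed.closure_eq] at this
  countable := inferInstance
  pairwise_disjoint := hdisj
  component := hM
  all_components := by
    intro S hS
    obtain ⟨x, hxS, hx⟩ := (infinite_of_isOpen hS.1.isOpen hS.2.2.1).exists_notMem_finite
      (Set.finite_singleton 0)
    obtain ⟨i, hi⟩ := hcover x hx
    exact ⟨i, (hS.subset (hM i) hxS hi).antisymm ((hM i).subset hS hi hxS)⟩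
  basin := fun x hx => hx.elim

/-! ### Disjointness and covering -/

theorem padicBall_subset_of_mem {a x : ℤ_[2]} {l : ℕ} (hx : x ∈ padicBall 2 a l) :
    padicBall 2 a l ⊆ padicBall 2 x l := by
  intro y hy
  rw [mem_padicBall_iff] at *
  simpa using dvd_sub hy hx

theorem eq_of_two_pow_dvd_natCast_sub {l j k : ℕ} (hj : j < 2 ^ l) (hk : k < 2 ^ l)
    (h : (2 : ℤ_[2]) ^ l ∣ j - k) : j = k := by
  have h' : (((2 : ℕ) : ℤ_[2])) ^ l ∣ (((j : ℤ) - k : ℤ) : ℤ_[2]) := by exact_mod_cast h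
  rw [← Ideal.mem_span_singleton, ← PadicInt.norm_le_pow_iff_mem_span_pow,
    PadicInt.norm_int_le_pow_iff_dvd] at h'
  have h2 : (k : ℤ) ≡ j [ZMOD (2 ^ l : ℕ)] := Int.modEq_iff_dvd.mpr (by exact_mod_cast h')
  exact (Nat.ModEq.eq_of_lt_of_lt (Int.natCast_modEq_iff.mp h2) hk hj).symm

theorem exists_natCast_two_pow_dvd_sub (x : ℤ_[2]) (l : ℕ) :
    ∃ k : ℕ, k < 2 ^ l ∧ (2 : ℤ_[2]) ^ l ∣ x - k := by
  refine ⟨x.appr l, x.appr_lt l, ?_⟩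
  have := PadicInt.appr_spec l x
  rw [Ideal.mem_span_singleton] at this
  exact_mod_cast this

theorem two_pow_mul_odd_inj {n m : ℕ} {u v : ℤ_[2]} (hu : Odd u) (hv : Odd v)
    (h : 2 ^ n * u = 2 ^ m * v) : n = m := by
  wlog hnm : n ≤ m generalizing n m u v
  · exact (this hv hu h.symm (le_of_not_ge hnm)).symm
  obtain ⟨_ | d, rfl⟩ := Nat.exists_eq_add_of_le hnm
  · rfl
  · exfalso
    rw [pow_add, mul_assoc] at h
    rw [mul_left_cancel₀ (pow_ne_zero n two_ne_zero) h] at hu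
    exact PadicInt.not_even_of_odd hu ⟨2 ^ d * v, by ring⟩

theorem mem_componentA_iff {k : ℕ} {x : ℤ_[2]} :
    x ∈ componentA k ↔ ∃ u, x = 2 * u + 1 ∧ 2 ^ 2 ∣ u - k := by
  rw [componentA, mem_padicBall_iff]
  constructor
  · rintro ⟨c, hc⟩
    exact ⟨k + 4 * c, by linear_combination hc, c, by ring⟩
  · rintro ⟨u, rfl, c, hc⟩
    exact ⟨c, by linear_combination 2 * hc⟩

/-- `x = 2 ^ n * (1 + 4 v)` or `x = - 2 ^ n * (1 + 4 v)`, with a congruence for `v`. -/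
theorem mem_componentM_iff {t n k : ℕ} {x : ℤ_[2]} :
    x ∈ componentM t n k ↔ ∃ v, (x = 2 ^ n * (4 * v + 1) ∧ 2 ^ (t + 1) ∣ v - k) ∨
      (x = 2 ^ n * (4 * v - 1) ∧ 2 ^ (t + 1) ∣ v + k - 2 ^ t) := by
  rw [componentM, Set.mem_union, mem_padicBall_iff, mem_padicBall_iff, exists_or]
  refine or_congr ⟨?_, ?_⟩ ⟨?_, ?_⟩
  · rintro ⟨c, hc⟩
    exact ⟨k + 2 ^ (t + 1) * c, by linear_combination hc, c, by ring⟩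
  · rintro ⟨v, rfl, c, hc⟩
    exact ⟨c, by linear_combination 2 ^ n * 4 * hc⟩
  · rintro ⟨c, hc⟩
    exact ⟨2 ^ t - k + 2 ^ (t + 1) * c, by linear_combination hc, c, by ring⟩
  · rintro ⟨v, rfl, c, hc⟩
    exact ⟨c, by linear_combination 2 ^ n * 4 * hc⟩

theorem odd_four_mul_add_one (v : ℤ_[2]) : Odd (4 * v + 1) := ⟨2 * v, by ring⟩

theorem odd_four_mul_sub_one (v : ℤ_[2]) : Odd (4 * v - 1) := ⟨2 * v - 1, by ring⟩

theorem exists_odd_of_mem_componentM {t n k : ℕ} {x : ℤ_[2]} (hx : x ∈ componentM t n k) :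
    ∃ u, Odd u ∧ x = 2 ^ n * u := by
  obtain ⟨v, ⟨h, -⟩ | ⟨h, -⟩⟩ := mem_componentM_iff.mp hx
  · exact ⟨_, odd_four_mul_add_one v, h⟩
  · exact ⟨_, odd_four_mul_sub_one v, h⟩

theorem four_mul_add_one_ne_four_mul_sub_one (v w : ℤ_[2]) : 4 * v + 1 ≠ 4 * w - 1 := by
  intro h
  have h2 : (2 : ℤ_[2]) * 1 = 2 * (2 * (w - v)) := by linear_combination h
  exact PadicInt.not_even_of_odd odd_one
    (by rw [mul_left_cancel₀ two_ne_zero h2]; exact even_two_mul _)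

theorem componentM_disjoint {t n m j k : ℕ} (hj : j < 2 ^ (t + 1)) (hk : k < 2 ^ (t + 1))
    (h : (n, j) ≠ (m, k)) : Disjoint (componentM t n j) (componentM t m k) := by
  rw [Set.disjoint_left]
  intro x hx hy
  obtain ⟨u, hu, hxu⟩ := exists_odd_of_mem_componentM hx
  obtain ⟨v, hv, hxv⟩ := exists_odd_of_mem_componentM hy
  obtain rfl := two_pow_mul_odd_inj hu hv (hxu.symm.trans hxv)
  refine h (congrArg _ ?_)
  have h2 : (2 : ℤ_[2]) ^ n ≠ 0 := pow_ne_zero n two_ne_zero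
  have h4 : (4 : ℤ_[2]) ≠ 0 := OfNat.ofNat_ne_zero 4
  rw [mem_componentM_iff] at hx hy
  obtain ⟨v, ⟨hxv, hv⟩ | ⟨hxv, hv⟩⟩ := hx <;> obtain ⟨w, ⟨hxw, hw⟩ | ⟨hxw, hw⟩⟩ := hy <;>
    have he := mul_left_cancel₀ h2 (hxv.symm.trans hxw)
  · obtain rfl := mul_left_cancel₀ h4 (add_right_cancel he)
    exact eq_of_two_pow_dvd_natCast_sub hj hk (by simpa using dvd_sub hw hv)
  · exact (four_mul_add_one_ne_four_mul_sub_one _ _ he).elim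
  · exact (four_mul_add_one_ne_four_mul_sub_one _ _ he.symm).elim
  · obtain rfl := mul_left_cancel₀ h4 (sub_left_injective he)
    exact eq_of_two_pow_dvd_natCast_sub hj hk (by simpa using dvd_sub hv hw)

theorem componentA_disjoint {j k : ℕ} (hj : j < 2 ^ 2) (hk : k < 2 ^ 2) (h : j ≠ k) :
    Disjoint (componentA j) (componentA k) := by
  rw [Set.disjoint_left]
  intro x hx hy
  obtain ⟨u, hxu, hu⟩ := mem_componentA_iff.mp hx
  obtain ⟨v, hxv, hv⟩ := mem_componentA_iff.mp hy
  obtain rfl := mul_left_cancel₀ two_ne_zero (add_right_cancel (hxu.symm.trans hxv))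
  exact h (eq_of_two_pow_dvd_natCast_sub hj hk (by simpa using dvd_sub hv hu))

theorem odd_of_mem_componentA {k : ℕ} {x : ℤ_[2]} (hx : x ∈ componentA k) : Odd x := by
  obtain ⟨u, hu, -⟩ := mem_componentA_iff.mp hx
  exact ⟨u, hu⟩

theorem even_of_mem_componentM {t n k : ℕ} (hn : 1 ≤ n) {x : ℤ_[2]}
    (hx : x ∈ componentM t n k) : Even x := by
  obtain ⟨u, -, rfl⟩ := exists_odd_of_mem_componentM hx
  exact ((even_two.pow_of_ne_zero (by omega)).mul_right u)

theorem componentA_disjoint_componentM {t n j k : ℕ} (hn : 1 ≤ n) :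
    Disjoint (componentA j) (componentM t n k) :=
  Set.disjoint_left.mpr fun _ hx hy =>
    PadicInt.not_even_of_odd (odd_of_mem_componentA hx) (even_of_mem_componentM hn hy)

theorem exists_mem_componentA {x : ℤ_[2]} (hx : Odd x) : ∃ k < 4, x ∈ componentA k := by
  obtain ⟨u, rfl⟩ := hx
  obtain ⟨k, hk, h⟩ := exists_natCast_two_pow_dvd_sub u 2
  exact ⟨k, hk, mem_componentA_iff.mpr ⟨u, rfl, h⟩⟩

theorem exists_mem_componentM (t n : ℕ) {u : ℤ_[2]} (hu : Odd u) :
    ∃ k < 2 ^ (t + 1), 2 ^ n * u ∈ componentM t n k := by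
  obtain ⟨c, rfl⟩ := hu
  rcases PadicInt.even_or_odd c with ⟨v, rfl⟩ | ⟨v, rfl⟩
  · obtain ⟨k, hk, h⟩ := exists_natCast_two_pow_dvd_sub v (t + 1)
    exact ⟨k, hk, mem_componentM_iff.mpr ⟨v, Or.inl ⟨by ring, h⟩⟩⟩
  -- The odd part is `4(v + 1) - 1`, and the second ball has center `2^n (4(2^t - k) - 1)`, so `k ≡
  -- 2^t - (v + 1)`.
  · obtain ⟨k, hk, h⟩ := exists_natCast_two_pow_dvd_sub (2 ^ t - (v + 1)) (t + 1)
    refine ⟨k, hk, mem_componentM_iff.mpr ⟨v + 1, Or.inr ⟨by ring, ?_⟩⟩⟩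
    rw [← dvd_neg]
    convert h using 1
    ring

theorem isFiniteUnionOfBalls_padicBall (a : ℤ_[2]) (l : ℕ) :
    IsFiniteUnionOfBalls (padicBall 2 a l) :=
  ⟨{(a, l)}, by simp⟩

theorem isFiniteUnionOfBalls_union (a b : ℤ_[2]) (l : ℕ) :
    IsFiniteUnionOfBalls (padicBall 2 a l ∪ padicBall 2 b l) := by
  classical
  exact ⟨{(a, l), (b, l)}, by simp⟩

/-! ### Minimality of the components -/

theorem isMinimalComponent_componentA {q : ℕ} (hq : Odd q) (k : ℕ) :
    IsMinimalComponent (fun x : ℤ_[2] => fibAt x (2 + 12 * q)) (componentA k) := by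
  refine ⟨isClopen_padicBall _ _, isFiniteUnionOfBalls_padicBall _ _,
    ⟨1 + 2 * k, mem_padicBall_iff.mpr (by simp)⟩, ?_, ?_⟩
  · intro x hx
    obtain ⟨u, -, hu⟩ := exists_odd_fibAt_sub_self hq (odd_of_mem_componentA hx)
    rw [componentA, mem_padicBall_iff] at *
    simpa using dvd_add (Dvd.intro u hu.symm) hx
  · intro x hx
    refine (padicBall_subset_of_mem hx).trans (padicBall_subset_closure_orbit (E := {x | Odd x})
      ?_ (fun y hy => exists_odd_fibAt_sub_self hq hy)
      (fun y hy z hz => fibAt_sub_self_sub_dvd_of_odd hy hz) (odd_of_mem_componentA hx))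
    intro y hy
    obtain ⟨u, -, hu⟩ := exists_odd_fibAt_sub_self hq hy
    change Odd (fibAt y (2 + 12 * q))
    rw [sub_eq_iff_eq_add.mp hu]
    exact Even.add_odd ⟨4 * u, by ring⟩ hy

theorem padicBall_subset_closure_orbit_of_even {q : ℕ} (hq : Odd q) {n : ℕ} (hn : 1 ≤ n)
    {u : ℤ_[2]} (hu : Odd u) :
    padicBall 2 (2 ^ n * u) (n + digitT q + 3) ⊆
      closure (Set.range fun i : ℕ => (fun x : ℤ_[2] => fibAt x (2 + 12 * q))^[i] (2 ^ n * u)) := by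
  set f : ℤ_[2] → ℤ_[2] := fun x => fibAt x (2 + 12 * q) with hf
  have hev {x : ℤ_[2]} (hx : x ∈ {x : ℤ_[2] | ∃ u, Odd u ∧ x = 2 ^ n * u}) : Even x := by
    obtain ⟨u, -, rfl⟩ := hx
    exact (even_two.pow_of_ne_zero (by omega)).mul_right u
  have hd : ∀ x ∈ {x : ℤ_[2] | ∃ u, Odd u ∧ x = 2 ^ n * u},
      ∃ u, Odd u ∧ f^[2] x - x = 2 ^ (n + digitT q + 3) * u := by
    intro x hx
    obtain ⟨v, hv, h⟩ := exists_odd_fibAt_fibAt_sub_self hq (hev hx)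
    obtain ⟨u, hu, rfl⟩ := hx
    exact ⟨u * v, hu.mul hv, by
      change fibAt (fibAt _ (2 + 12 * q)) (2 + 12 * q) - _ = _
      rw [h]; ring⟩
  have key := padicBall_subset_closure_orbit (E := {x : ℤ_[2] | ∃ u, Odd u ∧ x = 2 ^ n * u})
    (L := n + digitT q + 3) (h := f^[2]) ?_ hd
    (fun x hx y hy => fibAt_fibAt_sub_self_sub_dvd_of_even hq (hev hx) (hev hy)) ⟨u, hu, rfl⟩
  · refine key.trans (closure_mono ?_)
    rintro _ ⟨i, rfl⟩
    exact ⟨2 * i, by simp only [Function.iterate_mul]⟩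
  · intro x hx
    obtain ⟨v, -, hv⟩ := hd x hx
    obtain ⟨u, hu, rfl⟩ := hx
    refine ⟨u + 2 * (2 ^ (digitT q + 2) * v), hu.add_even (even_two_mul _), ?_⟩
    rw [sub_eq_iff_eq_add.mp hv]
    ring

/-- Modulo `2^(n+t+3)`, `f(x) ≡ -x + 2^(n+t+2)`, so `f` exchanges balls whose centers sum to
`2^(n+t+2)`. -/
theorem fibAt_mem_padicBall_of_even {q : ℕ} (hq : Odd q) {n : ℕ} (hn : 1 ≤ n) {a b u : ℤ_[2]}
    (hu : Odd u) (hab : a + b = 2 ^ (n + digitT q + 2))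
    (hx : 2 ^ n * u ∈ padicBall 2 a (n + digitT q + 3)) :
    fibAt (2 ^ n * u) (2 + 12 * q) ∈ padicBall 2 b (n + digitT q + 3) := by
  obtain ⟨v, hv, h⟩ := exists_odd_fibAt_add_self hq
    ((even_two.pow_of_ne_zero (by omega : n ≠ 0)).mul_right u)
  obtain ⟨e, he⟩ := hu.mul hv
  rw [mem_padicBall_iff] at *
  obtain ⟨c, hc⟩ := hx
  exact ⟨e - c, by linear_combination h - hc - hab + 2 ^ (n + digitT q + 2) * he⟩

theorem isMinimalComponent_componentM {q : ℕ} (hq : Odd q) {n : ℕ} (hn : 1 ≤ n) (k : ℕ) :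
    IsMinimalComponent (fun x : ℤ_[2] => fibAt x (2 + 12 * q)) (componentM (digitT q) n k) := by
  have hab : (1 + 4 * (k : ℤ_[2])) * 2 ^ n + (2 ^ (digitT q + 2) - 1 - 4 * (k : ℤ_[2])) * 2 ^ n
      = 2 ^ (n + digitT q + 2) := by ring
  have hmaps : Set.MapsTo (fun x : ℤ_[2] => fibAt x (2 + 12 * q)) (componentM (digitT q) n k)
      (componentM (digitT q) n k) := by
    intro x hx
    obtain ⟨u, hu, rfl⟩ := exists_odd_of_mem_componentM hx
    rcases hx with hx | hx
    · exact Or.inr (fibAt_mem_padicBall_of_even hq hn hu hab hx)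
    · exact Or.inl (fibAt_mem_padicBall_of_even hq hn hu ((add_comm _ _).trans hab) hx)
  refine ⟨(isClopen_padicBall _ _).union (isClopen_padicBall _ _),
    isFiniteUnionOfBalls_union _ _ _, ⟨(1 + 4 * k) * 2 ^ n, Or.inl (mem_padicBall_iff.mpr (by simp))⟩, hmaps, ?_⟩
  intro x hx
  have hball {y : ℤ_[2]} (hy : y ∈ componentM (digitT q) n k) :
      padicBall 2 y (n + digitT q + 3) ⊆
        closure (Set.range fun i : ℕ => (fun x : ℤ_[2] => fibAt x (2 + 12 * q))^[i] y) := by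
    obtain ⟨u, hu, rfl⟩ := exists_odd_of_mem_componentM hy
    exact padicBall_subset_closure_orbit_of_even hq hn hu
  have h1 := hball hx
  have h2 := (hball (hmaps hx)).trans (closure_mono (t := Set.range fun i : ℕ =>
    (fun x : ℤ_[2] => fibAt x (2 + 12 * q))^[i] x) (by rintro _ ⟨i, rfl⟩; exact ⟨i + 1, rfl⟩))
  obtain ⟨u, hu, hxu⟩ := exists_odd_of_mem_componentM hx
  rcases hx with hx | hx
  · refine Set.union_subset ((padicBall_subset_of_mem hx).trans h1)
      ((padicBall_subset_of_mem ?_).trans h2)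
    rw [hxu] at hx ⊢
    exact fibAt_mem_padicBall_of_even hq hn hu hab hx
  · refine Set.union_subset ((padicBall_subset_of_mem ?_).trans h2)
      ((padicBall_subset_of_mem hx).trans h1)
    rw [hxu] at hx ⊢
    exact fibAt_mem_padicBall_of_even hq hn hu ((add_comm _ _).trans hab) hx

theorem mainTheorem3 (m q t : ℕ) (hq : Odd q) (hm : m = 2 + 12 * q) (ht : t = digitT q) :
    Function.IsFixedPt (fun x : ℤ_[2] => (fibPoly ℤ_[2] m).eval x) 0 ∧
    IsMinimalDecomposition (fun x : ℤ_[2] => (fibPoly ℤ_[2] m).eval x)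
      {0}
      (Sum.elim
        (fun k : Fin 4 => componentA k)
        (fun nk : {n : ℕ // 1 ≤ n} × Fin (2 ^ (t + 1)) => componentM t nk.1 nk.2))
      ∅ := by
  subst hm ht
  simp only [eval_fibPoly]
  have hf : fibAt (0 : ℤ_[2]) (2 + 12 * q) = 0 := by
    rw [show 2 + 12 * q = 2 * (1 + 6 * q) by ring]
    exact zero_dvd_iff.mp (dvd_fibAt_two_mul _)
  refine ⟨hf, isMinimalDecomposition_of_components hf ?_ ?_ ?_ ?_⟩
  · intro x hx
    obtain ⟨_ | n, u, hu, rfl⟩ := PadicInt.exists_eq_two_pow_mul_odd hx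
    · obtain ⟨k, hk, h⟩ := exists_mem_componentA hu
      exact ⟨Sum.inl ⟨k, hk⟩, by simpa using h⟩
    · obtain ⟨k, hk, h⟩ := exists_mem_componentM (digitT q) (n + 1) hu
      exact ⟨Sum.inr (⟨n + 1, by omega⟩, ⟨k, hk⟩), h⟩
  · rintro (k | ⟨n, k⟩) h
    · exact PadicInt.not_even_of_odd (odd_of_mem_componentA h) Even.zero
    · obtain ⟨u, hu, h⟩ := exists_odd_of_mem_componentM h
      rw [(mul_eq_zero.mp h.symm).resolve_left (pow_ne_zero _ two_ne_zero)] at hu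
      exact PadicInt.not_even_of_odd hu Even.zero
  · rintro (j | ⟨n, j⟩) (k | ⟨m, k⟩) hne
    · exact componentA_disjoint j.2 k.2 fun h => hne (by rw [Fin.ext h])
    · exact componentA_disjoint_componentM m.2
    · exact (componentA_disjoint_componentM n.2).symm
    · refine componentM_disjoint j.2 k.2 fun h => hne ?_
      obtain ⟨h1, h2⟩ := Prod.mk.inj h
      exact congrArg Sum.inr (Prod.ext (Subtype.ext h1) (Fin.ext h2))
  · rintro (k | ⟨n, k⟩)
    · exact isMinimalComponent_componentA hq k
    · exact isMinimalComponent_componentM hq n.2 k
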